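/- Let $n\ge 3$, $m\ge 1$. Write $\mathbb{B}^n$ for the open unit ball and $\mathbb{S}^{n-1}$ for the unit sphere of $\mathbb{R}^n$, $|\cdot|$ for the Euclidean norm, and $\sigma$ for the normalized surface measure on $\mathbb{S}^{n-1}$. Let $g:\overline{\mathbb{B}^n}\to\mathbb{R}^m$ be continuous, and let $f:\overline{\mathbb{B}^n}\to\mathbb{R}^m$ be continuous, of class $C^2$ in $\mathbb{B}^n$, with $\Delta f=g$ in $\mathbb{B}^n$. Put $$\mathcal{P}_f(x)=\int_{\mathbb{S}^{n-1}}\frac{1-|x|^2}{|x-\zeta|^n}\,f(\zeta)\,d\sigma(\zeta)\quad(x\in\mathbb{B}^n),\qquad \|\mathcal{P}_f\|_\infty=\sup_{x\in\mathbb{B}^n}|\mathcal{P}_f(x)|,\qquad \|g\|_\infty=\sup_{x\in\mathbb{B}^n}|g(x)|.$$ Then, for every $x\in\overline{\mathbb{B}^n}$, $$\left|f(x)-\frac{1-|x|}{(1+|x|)^{n-1}}\,\mathcal{P}_f(0)\right|\le\|\mathcal{P}_f\|_\infty\left[1-\frac{1-|x|}{(1+|x|)^{n-1}}\right]+\frac{\|g\|_\infty}{2n}\,(1-|x|^2).$$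 The inequality is sharp on $\mathbb{S}^{n-1}\cup\{0\}$: for every $M>0$, the functions $g(x)=(-2nM,0,\ldots,0)$ and $f(x)=(M(1-|x|^2),0,\ldots,0)$ satisfy the hypotheses, and for them equality holds at every $x\in\mathbb{S}^{n-1}\cup\{0\}$. -/

import Mathlib

open MeasureTheory Metric

noncomputable section

namespace PoissonBall

/-- Normalized surface measure on the unit sphere of `ℝⁿ`. -/
def sphereMeasure (n : ℕ) : Measure (sphere (0 : EuclideanSpace ℝ (Fin n)) 1) :=
  ((volume : Measure (EuclideanSpace ℝ (Fin n))).toSphere Set.univ)⁻¹ •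
    (volume : Measure (EuclideanSpace ℝ (Fin n))).toSphere

/-- The Poisson kernel `P(x, ζ) = (1 - |x|²) / |x - ζ|ⁿ` of the unit ball of `ℝⁿ`. -/
def kernel {n : ℕ} (x ζ : EuclideanSpace ℝ (Fin n)) : ℝ :=
  (1 - ‖x‖ ^ 2) / ‖x - ζ‖ ^ n

/-- The Poisson integral of the boundary values of `f`. -/
def poissonIntegral {n m : ℕ} (f : EuclideanSpace ℝ (Fin n) → EuclideanSpace ℝ (Fin m))
    (x : EuclideanSpace ℝ (Fin n)) : EuclideanSpace ℝ (Fin m) :=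
  ∫ ζ : sphere (0 : EuclideanSpace ℝ (Fin n)) 1,
    kernel x (ζ : EuclideanSpace ℝ (Fin n)) • f (ζ : EuclideanSpace ℝ (Fin n)) ∂(sphereMeasure n)

/-- The supremum of `|u|` over the open unit ball. -/
def supNorm {n m : ℕ} (u : EuclideanSpace ℝ (Fin n) → EuclideanSpace ℝ (Fin m)) : ℝ :=
  sSup ((fun x => ‖u x‖) '' ball (0 : EuclideanSpace ℝ (Fin n)) 1)

/-- `f` is a classical solution of `Δ f = g` in the open unit ball: `g` is continuous on the
closed ball, and `f` is twice continuously differentiable in the open ball and continuous up to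
the boundary. -/
structure IsClassicalSolution {n m : ℕ}
    (f g : EuclideanSpace ℝ (Fin n) → EuclideanSpace ℝ (Fin m)) : Prop where
  continuousOn_rhs : ContinuousOn g (closedBall 0 1)
  contDiffOn : ContDiffOn ℝ 2 f (ball 0 1)
  continuousOn : ContinuousOn f (closedBall 0 1)
  laplacian_eq : ∀ x ∈ ball (0 : EuclideanSpace ℝ (Fin n)) 1, Laplacian.laplacian f x = g x

end PoissonBall

end

/-!
The proof splits `f` into its Poisson integral and a remainder with zero boundary values, and
controls both with the weak maximum principle instead of the Green function.

*The Poisson part.* Write `c = (1 - |x|) / (1 + |x|) ^ (n - 1)`. On the sphere the kernel satisfies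
`c ≤ P(x, ζ)`, and `P(0, ζ) = 1`, so `P_f(x) - c P_f(0)` is the integral of `f` against the
nonnegative kernel `P(x, ζ) - c` of total mass `1 - c` (`norm_poisson_sub_le`). The boundary values
of `f` are bounded by `‖P_f‖_∞` because they are limits of `P_f` (`tendsto_poisson`).

*The remainder.* For a vector `e`, the function `⟨e, f - P_f⟩` vanishes on the sphere and has
Laplacian `⟨e, g⟩ ≥ -|e| ‖g‖_∞`, while `|e| ‖g‖_∞ (1 - |x|²) / (2n)` has Laplacian `-|e| ‖g‖_∞`.
The maximum principle compares the two (`sub_poisson_le`); taking `e = f x - P_f x` gives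
`|f - P_f| ≤ ‖g‖_∞ (1 - |x|²) / (2n)`.

*The maximum principle.* It is proved for functions whose discrete Laplacians converge
(`HasSymmLaplacian`, `nonpos_of_hasSymmLaplacian_nonneg`). For `C²` functions the limit is the
usual Laplacian, and for the Poisson integral it is zero by dominated convergence
(`hasSymmLaplacian_poisson`), so that differentiability of `P_f` is never needed.
The same principle shows that the kernel has mass one (`poisson_one`): its mass is a rotation
invariant harmonic function of `x`, hence constant.

For the extremal pair `f` vanishes on the sphere, so `P_f = 0` and `‖g‖_∞ = 2nM`, and both sides
reduce to `M` at the origin and to `0` on the sphere.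
-/

namespace PoissonBall

open Filter Topology

/-! ### Symmetric second differences on the line -/

section SecondDifference

/-- Only the second derivative at the base point is needed, by l'Hôpital's rule. -/
theorem tendsto_second_difference {φ φ' : ℝ → ℝ} {c : ℝ}
    (hφ : ∀ᶠ t in 𝓝 (0 : ℝ), HasDerivAt φ (φ' t) t) (hφ' : HasDerivAt φ' c 0) :
    Tendsto (fun t => (φ t + φ (-t) - 2 * φ 0) / t ^ 2) (𝓝[≠] 0) (𝓝 c) := by
  have hneg : Tendsto (fun t : ℝ => -t) (𝓝 0) (𝓝 0) := by
    simpa using (continuous_neg (G := ℝ)).tendsto 0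
  have hcont : ContinuousAt φ 0 := hφ.self_of_nhds.continuousAt
  have hcomp : HasDerivAt (fun t => φ' t - φ' (-t)) (c + c) 0 := by
    have h := (hφ'.comp_of_eq (0 : ℝ) (hasDerivAt_neg (0 : ℝ)) (by simp))
    exact (hφ'.sub h).congr_deriv (by ring)
  refine HasDerivAt.lhopital_zero_nhdsNE (f' := fun t => φ' t - φ' (-t)) (g' := fun t => 2 * t)
    ?_ ?_ ?_ ?_ ?_ ?_
  · filter_upwards [nhdsWithin_le_nhds hφ, nhdsWithin_le_nhds (hneg.eventually hφ)] with t h1 h2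
    have h3 := h2.comp t (hasDerivAt_neg t)
    exact ((h1.add h3).sub_const (2 * φ 0)).congr_deriv (by ring)
  · refine Eventually.of_forall fun t => ?_
    simpa using hasDerivAt_pow 2 t
  · filter_upwards [self_mem_nhdsWithin] with t ht
    simpa using ht
  · have h : Tendsto (fun t => φ t + φ (-t) - 2 * φ 0) (𝓝 0) (𝓝 (φ 0 + φ 0 - 2 * φ 0)) :=
      (hcont.tendsto.add (hcont.tendsto.comp hneg)).sub_const _
    rw [show φ 0 + φ 0 - 2 * φ 0 = 0 by ring] at h
    exact h.mono_left nhdsWithin_le_nhds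
  · have h : Tendsto (fun t : ℝ => t ^ 2) (𝓝 0) (𝓝 (0 ^ 2)) := (continuous_pow 2).tendsto 0
    simpa using h.mono_left nhdsWithin_le_nhds
  · have h := (hasDerivAt_iff_tendsto_slope.1 hcomp).div_const 2
    rw [show (c + c) / 2 = c by ring] at h
    refine h.congr' ?_
    filter_upwards [self_mem_nhdsWithin] with t ht
    have ht' : t ≠ 0 := ht
    simp only [slope_def_field, sub_zero, neg_zero, sub_self]
    field_simp

/-- The uniform bound that allows dominated convergence for second differences under an integral. -/
theorem abs_second_difference_le {φ φ' φ'' : ℝ → ℝ} {δ C : ℝ}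
    (hφ : ∀ t, |t| ≤ δ → HasDerivAt φ (φ' t) t)
    (hφ' : ∀ t, |t| ≤ δ → HasDerivAt φ' (φ'' t) t) (hC : ∀ t, |t| ≤ δ → |φ'' t| ≤ C)
    {t : ℝ} (ht : |t| ≤ δ) : |φ t + φ (-t) - 2 * φ 0| ≤ 2 * C * t ^ 2 := by
  have hmem : ∀ s ∈ Set.Icc (-|t|) |t|, |s| ≤ |t| := fun s hs => abs_le.2 hs
  have hneg : ∀ s ∈ Set.Icc (-|t|) |t|, -s ∈ Set.Icc (-|t|) |t| :=
    fun s hs => ⟨by linarith [hs.2], by linarith [hs.1]⟩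
  have hC0 : 0 ≤ C := (abs_nonneg _).trans (hC t ht)
  have h1 : ∀ s ∈ Set.Icc (-|t|) |t|, ‖φ' s - φ' (-s)‖ ≤ 2 * C * |t| := fun s hs => by
    have := (convex_Icc (-|t|) |t|).norm_image_sub_le_of_norm_hasDerivWithin_le
      (f := φ') (f' := φ'') (C := C)
      (fun r hr => (hφ' r ((hmem r hr).trans ht)).hasDerivWithinAt)
      (fun r hr => hC r ((hmem r hr).trans ht)) (hneg s hs) hs
    refine this.trans ?_
    have h2 : ‖s - -s‖ = 2 * |s| := by
      rw [Real.norm_eq_abs, show s - -s = 2 * s by ring, abs_mul, abs_two]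
    rw [h2]
    nlinarith [hmem s hs]
  have h3 := (convex_Icc (-|t|) |t|).norm_image_sub_le_of_norm_hasDerivWithin_le
      (f := fun s => φ s + φ (-s)) (f' := fun s => φ' s - φ' (-s)) (C := 2 * C * |t|)
      (x := 0) (y := t)
      (fun r hr => by
        have h4 := (hφ (-r) ((hmem _ (hneg r hr)).trans ht)).comp r (hasDerivAt_neg r)
        exact (((hφ r ((hmem r hr).trans ht)).add h4).congr_deriv (by ring)).hasDerivWithinAt)
      h1 ⟨by simp, by simp⟩ (abs_le.1 le_rfl)
  simp only [neg_zero, sub_zero, Real.norm_eq_abs] at h3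
  calc |φ t + φ (-t) - 2 * φ 0| = |φ t + φ (-t) - (φ 0 + φ 0)| := by ring_nf
    _ ≤ 2 * C * |t| * |t| := h3
    _ = 2 * C * t ^ 2 := by rw [mul_assoc, abs_mul_abs_self]; ring

end SecondDifference

/-! ### Discrete Laplacians and the weak maximum principle -/

section MaximumPrinciple

variable {E ι : Type*} [NormedAddCommGroup E] [InnerProductSpace ℝ E] [Fintype ι]

/-- The sum over an orthonormal basis `b` of the symmetric second differences of `u` at `x` with
step `t`. -/
noncomputable def secondDiff (b : OrthonormalBasis ι ℝ E) (u : E → ℝ) (x : E) (t : ℝ) : ℝ :=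
  ∑ i, (u (x + t • b i) + u (x - t • b i) - 2 * u x)

/-- `u` has Laplacian `l` at `x` in the weak pointwise sense that the discrete Laplacians in the
directions of `b`, with step `t`, converge to `l` as `t → 0`. -/
def HasSymmLaplacian (b : OrthonormalBasis ι ℝ E) (u : E → ℝ) (x : E) (l : ℝ) : Prop :=
  Tendsto (fun t => secondDiff b u x t / t ^ 2) (𝓝[≠] 0) (𝓝 l)

variable {b : OrthonormalBasis ι ℝ E} {u v : E → ℝ} {x : E} {k l : ℝ}

theorem HasSymmLaplacian.sub (hu : HasSymmLaplacian b u x k) (hv : HasSymmLaplacian b v x l) :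
    HasSymmLaplacian b (fun y => u y - v y) x (k - l) := by
  refine (Tendsto.sub hu hv).congr fun t => ?_
  rw [← sub_div, secondDiff, secondDiff, secondDiff, ← Finset.sum_sub_distrib]
  congr 1
  exact Finset.sum_congr rfl fun i _ => by ring

theorem HasSymmLaplacian.const_mul (a : ℝ) (hu : HasSymmLaplacian b u x k) :
    HasSymmLaplacian b (fun y => a * u y) x (a * k) := by
  refine (Tendsto.const_mul a hu).congr fun t => ?_
  rw [← mul_div_assoc, secondDiff, secondDiff, Finset.mul_sum]
  congr 1
  exact Finset.sum_congr rfl fun i _ => by ring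

theorem hasSymmLaplacian_const (b : OrthonormalBasis ι ℝ E) (a : ℝ) (x : E) :
    HasSymmLaplacian b (fun _ => a) x 0 := by
  refine tendsto_const_nhds.congr fun t => ?_
  simp [secondDiff, two_mul]

theorem HasSymmLaplacian.congr_of_eventuallyEq (hu : HasSymmLaplacian b u x l)
    (h : v =ᶠ[𝓝 x] u) : HasSymmLaplacian b v x l := by
  refine Tendsto.congr' ?_ hu
  have hline (c : E) : ∀ᶠ t : ℝ in 𝓝[≠] 0, v (x + t • c) = u (x + t • c) := by
    refine nhdsWithin_le_nhds ?_
    have hc : Tendsto (fun t : ℝ => x + t • c) (𝓝 0) (𝓝 x) := by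
      have : Continuous fun t : ℝ => x + t • c := by fun_prop
      simpa using this.tendsto 0
    exact hc.eventually h
  filter_upwards [eventually_all.2 fun i => hline (b i), eventually_all.2 fun i => hline (-b i)]
    with t h1 h2
  rw [secondDiff, secondDiff]
  congr 1
  refine Finset.sum_congr rfl fun i _ => ?_
  have h3 := h2 i
  rw [smul_neg, ← sub_eq_add_neg] at h3
  rw [h1 i, h3, h.self_of_nhds]

theorem secondDiff_norm_sq (b : OrthonormalBasis ι ℝ E) (x : E) (t : ℝ) :
    secondDiff b (fun y => ‖y‖ ^ 2) x t = 2 * Fintype.card ι * t ^ 2 := by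
  have h (i : ι) : ‖x + t • b i‖ ^ 2 + ‖x - t • b i‖ ^ 2 - 2 * ‖x‖ ^ 2 = 2 * t ^ 2 := by
    rw [norm_add_sq_real, norm_sub_sq_real, norm_smul, b.norm_eq_one, mul_one, Real.norm_eq_abs,
      sq_abs]
    ring
  simp only [secondDiff, h, Finset.sum_const, Finset.card_univ, nsmul_eq_mul]
  ring

theorem hasSymmLaplacian_norm_sq (b : OrthonormalBasis ι ℝ E) (x : E) :
    HasSymmLaplacian b (fun y => ‖y‖ ^ 2) x (2 * Fintype.card ι) := by
  refine tendsto_const_nhds.congr' ?_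
  filter_upwards [self_mem_nhdsWithin] with t ht
  have ht' : t ≠ 0 := ht
  rw [secondDiff_norm_sq]
  field_simp

theorem hasSymmLaplacian_laplacian [FiniteDimensional ℝ E] (b : OrthonormalBasis ι ℝ E)
    (hu : ContDiffAt ℝ 2 u x) : HasSymmLaplacian b u x (Laplacian.laplacian u x) := by
  have hlap : Laplacian.laplacian u x = ∑ i, fderiv ℝ (fderiv ℝ u) x (b i) (b i) := by
    rw [InnerProductSpace.laplacian_eq_iteratedFDeriv_orthonormalBasis u b]
    simp [iteratedFDeriv_two_apply]
  rw [HasSymmLaplacian, hlap]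
  simp only [secondDiff, Finset.sum_div]
  refine tendsto_finsetSum _ fun i _ => ?_
  have hline (t : ℝ) : HasDerivAt (fun s : ℝ => x + s • b i) (b i) t := by
    simpa using ((hasDerivAt_id t).smul_const (b i)).const_add x
  have hlim : Tendsto (fun t : ℝ => x + t • b i) (𝓝 0) (𝓝 x) := by
    simpa using (hline 0).continuousAt.tendsto
  have hdiff : ∀ᶠ y in 𝓝 x, DifferentiableAt ℝ u y := by
    filter_upwards [hu.eventually (by simp)] with y hy
    exact hy.differentiableAt (by simp)
  have hd2 : DifferentiableAt ℝ (fderiv ℝ u) x :=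
    (hu.fderiv_right (m := 1) (by norm_num)).differentiableAt (by simp)
  have h := tendsto_second_difference (φ := fun t => u (x + t • b i))
    (φ' := fun t => fderiv ℝ u (x + t • b i) (b i)) (c := fderiv ℝ (fderiv ℝ u) x (b i) (b i))
    (by
      filter_upwards [hlim.eventually hdiff] with t ht
      exact ht.hasFDerivAt.comp_hasDerivAt t (hline t))
    (by
      have h1 : HasDerivAt (fun t : ℝ => fderiv ℝ u (x + t • b i))
          (fderiv ℝ (fderiv ℝ u) x (b i)) 0 :=
        HasFDerivAt.comp_hasDerivAt_of_eq (0 : ℝ) hd2.hasFDerivAt (hline 0) (by simp)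
      exact h1.clm_apply (hasDerivAt_const _ _) |>.congr_deriv (by simp))
  simpa [sub_eq_add_neg] using h

/-- Weak maximum principle. Adding `ε |x|²` makes the Laplacian strictly positive, which is
impossible at an interior maximum because the second differences are nonpositive there. -/
theorem nonpos_of_hasSymmLaplacian_nonneg [FiniteDimensional ℝ E] [Nonempty ι] {r : ℝ}
    (hu : ContinuousOn u (closedBall 0 r))
    (hlap : ∀ x ∈ ball (0 : E) r, ∃ l, 0 ≤ l ∧ HasSymmLaplacian b u x l)
    (hbd : ∀ x ∈ sphere (0 : E) r, u x ≤ 0) : ∀ x ∈ closedBall (0 : E) r, u x ≤ 0 := by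
  intro x₀ hx₀
  by_contra! hpos
  have hr1 : 0 < r ^ 2 + 1 := by positivity
  -- With this `ε` the perturbation `ε r²` on the sphere stays below `u x₀`.
  set ε : ℝ := u x₀ / (r ^ 2 + 1) with hε
  have hε0 : 0 < ε := div_pos hpos hr1
  have hε1 : ε * (r ^ 2 + 1) = u x₀ := div_mul_cancel₀ _ hr1.ne'
  obtain ⟨x₁, hx₁, hmax⟩ := (isCompact_closedBall (0 : E) r).exists_isMaxOn ⟨x₀, hx₀⟩
    (f := fun y => u y + ε * ‖y‖ ^ 2) (hu.add (by fun_prop))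
  have hx₁' : x₁ ∈ ball (0 : E) r := by
    rcases (mem_closedBall.1 hx₁).lt_or_eq with h | h
    · exact h
    · have h1 : u x₀ + ε * ‖x₀‖ ^ 2 ≤ u x₁ + ε * ‖x₁‖ ^ 2 := hmax hx₀
      have h2 := hbd x₁ h
      rw [dist_zero_right] at h
      rw [h] at h1
      nlinarith [sq_nonneg ‖x₀‖]
  obtain ⟨l, hl, hlim⟩ := hlap x₁ hx₁'
  have hlim' : HasSymmLaplacian b (fun y => u y + ε * ‖y‖ ^ 2) x₁
      (l + ε * (2 * Fintype.card ι)) := by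
    have h := hlim.sub ((hasSymmLaplacian_norm_sq b x₁).const_mul (-ε))
    simpa [HasSymmLaplacian] using h
  have hnon : l + ε * (2 * Fintype.card ι) ≤ 0 := by
    refine le_of_tendsto hlim' ?_
    have hline (c : E) : ∀ᶠ t : ℝ in 𝓝[≠] 0, x₁ + t • c ∈ closedBall (0 : E) r := by
      refine nhdsWithin_le_nhds ?_
      have hc : Tendsto (fun t : ℝ => x₁ + t • c) (𝓝 0) (𝓝 x₁) := by
        have : Continuous fun t : ℝ => x₁ + t • c := by fun_prop
        simpa using this.tendsto 0
      filter_upwards [hc.eventually (isOpen_ball.mem_nhds hx₁')] with t ht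
      exact ball_subset_closedBall ht
    filter_upwards [eventually_all.2 fun i => hline (b i), eventually_all.2 fun i => hline (-b i)]
      with t h1 h2
    refine div_nonpos_of_nonpos_of_nonneg (Finset.sum_nonpos fun i _ => ?_) (sq_nonneg t)
    have h3 := h2 i
    rw [smul_neg, ← sub_eq_add_neg] at h3
    have h4 := hmax (h1 i)
    have h5 := hmax h3
    simp only [Set.mem_ofPred_eq] at h4 h5
    linarith
  have hcard : (0 : ℝ) < Fintype.card ι := by exact_mod_cast Fintype.card_pos
  nlinarith [mul_pos hε0 hcard]

end MaximumPrinciple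

/-! ### Harmonicity of the Poisson kernel -/

section Kernel

variable {n : ℕ}

theorem sub_ne_zero_of_mem_ball {x ζ : EuclideanSpace ℝ (Fin n)} (hx : ‖x‖ < 1)
    (hζ : ‖ζ‖ = 1) : x - ζ ≠ 0 := by
  rintro h
  rw [sub_eq_zero.1 h] at hx
  exact hx.ne hζ

theorem kernel_nonneg {x ζ : EuclideanSpace ℝ (Fin n)} (hx : ‖x‖ < 1) : 0 ≤ kernel x ζ :=
  div_nonneg (by nlinarith [norm_nonneg x]) (by positivity)

/-- Powers of `|x - ζ|²` are smooth along lines, without the square root in the norm. -/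
theorem kernel_eq_rpow (x ζ : EuclideanSpace ℝ (Fin n)) :
    kernel x ζ = (1 - ‖x‖ ^ 2) * (‖x - ζ‖ ^ 2) ^ (-(n : ℝ) / 2) := by
  rw [kernel, div_eq_mul_inv, ← Real.rpow_natCast ‖x - ζ‖ 2, ← Real.rpow_mul (norm_nonneg _),
    ← Real.rpow_natCast ‖x - ζ‖ n, ← Real.rpow_neg (norm_nonneg _)]
  congr 2
  push_cast
  ring

/-- The derivative of `kernel · ζ` at `x` in the direction `v`. -/
noncomputable def kernelDeriv (x v ζ : EuclideanSpace ℝ (Fin n)) : ℝ :=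
  -(2 * inner ℝ x v) * (‖x - ζ‖ ^ 2) ^ (-(n : ℝ) / 2) +
    (1 - ‖x‖ ^ 2) * (2 * inner ℝ (x - ζ) v * (-(n : ℝ) / 2) *
      (‖x - ζ‖ ^ 2) ^ (-(n : ℝ) / 2 - 1))

/-- The second derivative of `kernel · ζ` at `x` in the direction of a unit vector `v`. -/
noncomputable def kernelDeriv₂ (x v ζ : EuclideanSpace ℝ (Fin n)) : ℝ :=
  -2 * (‖x - ζ‖ ^ 2) ^ (-(n : ℝ) / 2) +
    2 * (-(2 * inner ℝ x v) * (2 * inner ℝ (x - ζ) v * (-(n : ℝ) / 2) *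
      (‖x - ζ‖ ^ 2) ^ (-(n : ℝ) / 2 - 1))) +
    (1 - ‖x‖ ^ 2) * (2 * (-(n : ℝ) / 2) * (‖x - ζ‖ ^ 2) ^ (-(n : ℝ) / 2 - 1) +
      (2 * inner ℝ (x - ζ) v) ^ 2 * (-(n : ℝ) / 2) * (-(n : ℝ) / 2 - 1) *
        (‖x - ζ‖ ^ 2) ^ (-(n : ℝ) / 2 - 2))

variable {x v ζ : EuclideanSpace ℝ (Fin n)} {t : ℝ}

theorem hasDerivAt_norm_sq_line (y v : EuclideanSpace ℝ (Fin n)) (t : ℝ) :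
    HasDerivAt (fun s : ℝ => ‖y + s • v‖ ^ 2) (2 * inner ℝ (y + t • v) v) t := by
  have hline : HasDerivAt (fun s : ℝ => y + s • v) v t := by
    simpa using ((hasDerivAt_id t).smul_const v).const_add y
  exact hline.norm_sq

theorem hasDerivAt_inner_line (y : EuclideanSpace ℝ (Fin n)) (hv : ‖v‖ = 1) (t : ℝ) :
    HasDerivAt (fun s : ℝ => inner ℝ (y + s • v) v) 1 t := by
  have hline : HasDerivAt (fun s : ℝ => y + s • v) v t := by
    simpa using ((hasDerivAt_id t).smul_const v).const_add y
  exact (hline.inner ℝ (hasDerivAt_const t v)).congr_deriv (by simp [hv])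

theorem hasDerivAt_rpow_line (p : ℝ) (h : x + t • v - ζ ≠ 0) :
    HasDerivAt (fun s : ℝ => (‖x + s • v - ζ‖ ^ 2) ^ p)
      (2 * inner ℝ (x + t • v - ζ) v * p * (‖x + t • v - ζ‖ ^ 2) ^ (p - 1)) t := by
  have hq : HasDerivAt (fun s : ℝ => ‖x + s • v - ζ‖ ^ 2) (2 * inner ℝ (x + t • v - ζ) v) t := by
    simpa only [sub_add_eq_add_sub] using hasDerivAt_norm_sq_line (x - ζ) v t
  exact hq.rpow_const (Or.inl (by simpa using h))

theorem hasDerivAt_kernel_line (h : x + t • v - ζ ≠ 0) :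
    HasDerivAt (fun s : ℝ => kernel (x + s • v) ζ) (kernelDeriv (x + t • v) v ζ) t := by
  simp only [kernel_eq_rpow]
  exact ((hasDerivAt_norm_sq_line x v t).const_sub 1).mul (hasDerivAt_rpow_line _ h)

theorem hasDerivAt_kernelDeriv_line (hv : ‖v‖ = 1) (h : x + t • v - ζ ≠ 0) :
    HasDerivAt (fun s : ℝ => kernelDeriv (x + s • v) v ζ) (kernelDeriv₂ (x + t • v) v ζ) t := by
  have hN := (hasDerivAt_norm_sq_line x v t).const_sub 1
  have hN' := ((hasDerivAt_inner_line x hv t).const_mul 2).neg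
  have hq' : HasDerivAt (fun s : ℝ => 2 * inner ℝ (x + s • v - ζ) v) (2 * 1) t := by
    simpa only [sub_add_eq_add_sub] using (hasDerivAt_inner_line (x - ζ) hv t).const_mul 2
  have hmain := (hN'.mul (hasDerivAt_rpow_line (-(n : ℝ) / 2) h)).add
    (hN.mul ((hq'.mul_const (-(n : ℝ) / 2)).mul (hasDerivAt_rpow_line (-(n : ℝ) / 2 - 1) h)))
  refine hmain.congr_deriv ?_
  rw [kernelDeriv₂, show -(n : ℝ) / 2 - 1 - 1 = -(n : ℝ) / 2 - 2 by ring]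
  simp only [Pi.neg_apply, Pi.mul_apply]
  ring

/-- The Poisson kernel is harmonic in its first variable. -/
theorem sum_kernelDeriv₂_eq_zero {ι : Type*} [Fintype ι]
    (b : OrthonormalBasis ι ℝ (EuclideanSpace ℝ (Fin n))) (hζ : ‖ζ‖ = 1) (h : x - ζ ≠ 0) :
    ∑ i, kernelDeriv₂ x (b i) ζ = 0 := by
  have hcard : (Fintype.card ι : ℝ) = n := by
    have := Module.finrank_eq_card_basis b.toBasis
    rw [finrank_euclideanSpace_fin] at this
    exact_mod_cast this.symm
  have h1 : ∑ i, inner ℝ x (b i) * inner ℝ (x - ζ) (b i) = inner ℝ x (x - ζ) := by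
    rw [← b.sum_inner_mul_inner x (x - ζ)]
    simp only [real_inner_comm]
  have h2 : ∑ i, inner ℝ (x - ζ) (b i) ^ 2 = ‖x - ζ‖ ^ 2 := by
    rw [← real_inner_self_eq_norm_sq, ← b.sum_inner_mul_inner (x - ζ) (x - ζ)]
    simp only [real_inner_comm, sq]
  have hq : 0 < ‖x - ζ‖ ^ 2 := by positivity
  -- All powers of `q = |x - ζ|²` are expressed through `q ^ (-n/2 - 2)`.
  have hp1 : (‖x - ζ‖ ^ 2) ^ (-(n : ℝ) / 2 - 1) =
      (‖x - ζ‖ ^ 2) ^ (-(n : ℝ) / 2 - 2) * ‖x - ζ‖ ^ 2 := by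
    rw [← Real.rpow_add_one hq.ne']; congr 1; ring
  have hp0 : (‖x - ζ‖ ^ 2) ^ (-(n : ℝ) / 2) =
      (‖x - ζ‖ ^ 2) ^ (-(n : ℝ) / 2 - 2) * ‖x - ζ‖ ^ 2 * ‖x - ζ‖ ^ 2 := by
    rw [← hp1, ← Real.rpow_add_one hq.ne']; congr 1; ring
  set R := (‖x - ζ‖ ^ 2) ^ (-(n : ℝ) / 2 - 2)
  have hterm (i : ι) : kernelDeriv₂ x (b i) ζ =
      (-2 * (R * ‖x - ζ‖ ^ 2 * ‖x - ζ‖ ^ 2) - (1 - ‖x‖ ^ 2) * n * (R * ‖x - ζ‖ ^ 2)) +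
      4 * n * (R * ‖x - ζ‖ ^ 2) * (inner ℝ x (b i) * inner ℝ (x - ζ) (b i)) +
      (1 - ‖x‖ ^ 2) * n * (n + 2) * R * inner ℝ (x - ζ) (b i) ^ 2 := by
    rw [kernelDeriv₂, hp0, hp1]
    ring
  have hnorm : ‖x - ζ‖ ^ 2 = ‖x‖ ^ 2 - 2 * inner ℝ x ζ + 1 := by
    rw [norm_sub_sq_real, hζ]; ring
  have hinner : inner ℝ x (x - ζ) = ‖x‖ ^ 2 - inner ℝ x ζ := by
    rw [inner_sub_right, real_inner_self_eq_norm_sq]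
  simp only [hterm, Finset.sum_add_distrib, ← Finset.mul_sum, h1, h2, Finset.sum_const,
    Finset.card_univ, nsmul_eq_mul, hcard, hinner]
  clear_value R
  rw [hnorm]
  ring

theorem continuousOn_kernelDeriv₂ (v : EuclideanSpace ℝ (Fin n)) :
    ContinuousOn (fun p : EuclideanSpace ℝ (Fin n) × EuclideanSpace ℝ (Fin n) =>
      kernelDeriv₂ p.1 v p.2) {p | p.1 - p.2 ≠ 0} := by
  have hpow (s : ℝ) : ContinuousOn
      (fun p : EuclideanSpace ℝ (Fin n) × EuclideanSpace ℝ (Fin n) => (‖p.1 - p.2‖ ^ 2) ^ s)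
      {p | p.1 - p.2 ≠ 0} := by
    refine ContinuousOn.rpow_const (by fun_prop) fun p hp => Or.inl ?_
    have : p.1 - p.2 ≠ 0 := hp
    positivity
  have h0 := hpow (-(n : ℝ) / 2)
  have h1 := hpow (-(n : ℝ) / 2 - 1)
  have h2 := hpow (-(n : ℝ) / 2 - 2)
  unfold kernelDeriv₂
  fun_prop

theorem continuousOn_kernel :
    ContinuousOn (fun p : EuclideanSpace ℝ (Fin n) × EuclideanSpace ℝ (Fin n) =>
      kernel p.1 p.2) {p | p.1 - p.2 ≠ 0} := by
  unfold kernel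
  refine ContinuousOn.div (by fun_prop) (by fun_prop) fun p hp => ?_
  have : p.1 - p.2 ≠ 0 := hp
  positivity

theorem continuous_kernel_sphere (hx : ‖x‖ < 1) :
    Continuous fun ζ : sphere (0 : EuclideanSpace ℝ (Fin n)) 1 => kernel x ζ :=
  continuousOn_kernel.comp_continuous (f := fun ζ : sphere (0 : EuclideanSpace ℝ (Fin n)) 1 =>
    (x, (ζ : EuclideanSpace ℝ (Fin n)))) (by fun_prop)
    fun ζ => sub_ne_zero_of_mem_ball hx (mem_sphere_zero_iff_norm.1 ζ.2)

theorem hasSymmLaplacian_kernel {ι : Type*} [Fintype ι]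
    (b : OrthonormalBasis ι ℝ (EuclideanSpace ℝ (Fin n))) (hζ : ‖ζ‖ = 1) (hx : ‖x‖ < 1) :
    HasSymmLaplacian b (fun y => kernel y ζ) x 0 := by
  suffices h : HasSymmLaplacian b (fun y => kernel y ζ) x (∑ i, kernelDeriv₂ x (b i) ζ) by
    rwa [sum_kernelDeriv₂_eq_zero b hζ (sub_ne_zero_of_mem_ball hx hζ)] at h
  simp only [HasSymmLaplacian, secondDiff, Finset.sum_div]
  refine tendsto_finsetSum _ fun i _ => ?_
  have hcont : Continuous fun t : ℝ => x + t • b i - ζ := by fun_prop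
  have hne : ∀ᶠ t : ℝ in 𝓝 0, x + t • b i - ζ ≠ 0 :=
    hcont.continuousAt.eventually_ne (by simpa using sub_ne_zero_of_mem_ball hx hζ)
  have h := tendsto_second_difference (φ := fun t => kernel (x + t • b i) ζ)
    (hne.mono fun t ht => hasDerivAt_kernel_line ht)
    (hasDerivAt_kernelDeriv_line (b.norm_eq_one i) hne.self_of_nhds)
  simpa [sub_eq_add_neg] using h

/-- The bound is uniform in `ζ` because the second derivatives of the kernel are continuous on the
compact product of a small ball around `x` with the sphere. -/
theorem exists_secondDiff_kernel_bound {ι : Type*} [Fintype ι]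
    (b : OrthonormalBasis ι ℝ (EuclideanSpace ℝ (Fin n))) (hx : ‖x‖ < 1) :
    ∃ C : ℝ, ∀ᶠ t : ℝ in 𝓝[≠] 0, ∀ ζ : EuclideanSpace ℝ (Fin n), ‖ζ‖ = 1 →
      |secondDiff b (fun y => kernel y ζ) x t / t ^ 2| ≤ C := by
  set δ := (1 - ‖x‖) / 2 with hδ
  have hδ0 : 0 < δ := by linarith
  have hball : ∀ y ∈ closedBall x δ, ‖y‖ < 1 := fun y hy => by
    have h1 := norm_le_norm_add_norm_sub' y x
    rw [mem_closedBall, dist_eq_norm] at hy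
    linarith
  have hbound (i : ι) : ∃ C : ℝ, ∀ y ∈ closedBall x δ, ∀ ζ : EuclideanSpace ℝ (Fin n),
      ‖ζ‖ = 1 → |kernelDeriv₂ y (b i) ζ| ≤ C := by
    obtain ⟨C, hC⟩ := ((isCompact_closedBall x δ).prod
      (isCompact_sphere (0 : EuclideanSpace ℝ (Fin n)) 1)).exists_bound_of_continuousOn
      ((continuousOn_kernelDeriv₂ (b i)).mono fun p hp =>
        sub_ne_zero_of_mem_ball (hball _ hp.1) (mem_sphere_zero_iff_norm.1 hp.2))
    exact ⟨C, fun y hy ζ hζ => hC (y, ζ) ⟨hy, mem_sphere_zero_iff_norm.2 hζ⟩⟩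
  choose C hC using hbound
  refine ⟨∑ i, 2 * C i, ?_⟩
  have hsmall : ∀ᶠ t : ℝ in 𝓝[≠] 0, |t| ≤ δ := by
    refine nhdsWithin_le_nhds ?_
    filter_upwards [closedBall_mem_nhds (0 : ℝ) hδ0] with t ht
    simpa using ht
  filter_upwards [hsmall, self_mem_nhdsWithin] with t ht ht0 ζ hζ
  have ht0' : t ≠ 0 := ht0
  have hline (i : ι) (s : ℝ) (hs : |s| ≤ δ) : x + s • b i ∈ closedBall x δ := by
    simpa [norm_smul] using hs
  rw [abs_div, abs_of_nonneg (sq_nonneg t), div_le_iff₀ (by positivity), secondDiff, Finset.sum_mul]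
  refine (Finset.abs_sum_le_sum_abs _ _).trans (Finset.sum_le_sum fun i _ => ?_)
  have h := abs_second_difference_le (φ := fun t => kernel (x + t • b i) ζ)
    (fun s hs => hasDerivAt_kernel_line
      (sub_ne_zero_of_mem_ball (hball _ (hline i s hs)) hζ))
    (fun s hs => hasDerivAt_kernelDeriv_line (b.norm_eq_one i)
      (sub_ne_zero_of_mem_ball (hball _ (hline i s hs)) hζ))
    (fun s hs => hC i _ (hline i s hs) ζ hζ) ht
  simpa [sub_eq_add_neg] using h

end Kernel

/-! ### Rotation invariance of the normalized surface measure -/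

section SphereMeasure

variable {n : ℕ}

theorem isProbabilityMeasure_sphereMeasure (hn : n ≠ 0) :
    IsProbabilityMeasure (sphereMeasure n) := by
  have : NeZero n := ⟨hn⟩
  refine ⟨?_⟩
  rw [sphereMeasure, Measure.smul_apply, smul_eq_mul]
  exact ENNReal.inv_mul_cancel
    (Measure.measure_univ_ne_zero.2 (Measure.toSphere_ne_zero _))
    (measure_ne_top _ _)

instance : IsFiniteMeasure (sphereMeasure n) := by
  rcases eq_or_ne n 0 with rfl | hn
  · have h : (volume : Measure (EuclideanSpace ℝ (Fin 0))).toSphere = 0 := by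
      rw [Measure.toSphere_eq_zero_iff]; infer_instance
    rw [sphereMeasure, h, smul_zero]
    infer_instance
  · have := isProbabilityMeasure_sphereMeasure hn
    infer_instance

/-- The action of a linear isometry on the unit sphere. -/
noncomputable def sphereMap (A : EuclideanSpace ℝ (Fin n) ≃ₗᵢ[ℝ] EuclideanSpace ℝ (Fin n)) :
    sphere (0 : EuclideanSpace ℝ (Fin n)) 1 → sphere (0 : EuclideanSpace ℝ (Fin n)) 1 :=
  fun ζ => ⟨A ζ, by simp⟩

open Pointwise in
theorem measurePreserving_sphereMap
    (A : EuclideanSpace ℝ (Fin n) ≃ₗᵢ[ℝ] EuclideanSpace ℝ (Fin n)) :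
    MeasurePreserving (sphereMap A) (sphereMeasure n) (sphereMeasure n) := by
  have hmeas : Measurable (sphereMap A) :=
    (Continuous.subtype_mk (A.continuous.comp continuous_subtype_val) _).measurable
  refine MeasurePreserving.smul_measure ⟨hmeas, Measure.ext fun s hs => ?_⟩ _
  rw [Measure.map_apply hmeas hs, Measure.toSphere_apply' _ hs,
    Measure.toSphere_apply' _ (hmeas hs), ← A.measurePreserving.measure_preimage_emb
      A.toHomeomorph.measurableEmbedding (Set.Ioo (0 : ℝ) 1 • (Subtype.val '' s))]
  congr 2
  ext y
  simp only [Set.mem_smul, Set.mem_image, Set.mem_preimage]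
  constructor
  · rintro ⟨r, hr, _, ⟨ζ, hζ, rfl⟩, rfl⟩
    exact ⟨r, hr, _, ⟨_, hζ, rfl⟩, by simp [sphereMap]⟩
  · rintro ⟨r, hr, _, ⟨ζ, hζ, rfl⟩, h⟩
    refine ⟨r, hr, A.symm ζ, ⟨⟨A.symm ζ, by simp⟩, ?_, rfl⟩, ?_⟩
    · simpa [sphereMap] using hζ
    · rw [← map_smul, h, A.symm_apply_apply]

end SphereMeasure

/-! ### The Poisson integral -/

section Poisson

variable {n : ℕ} {G : Type*} [NormedAddCommGroup G]
  {F : EuclideanSpace ℝ (Fin n) → G} {x : EuclideanSpace ℝ (Fin n)}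

theorem kernel_zero {ζ : EuclideanSpace ℝ (Fin n)} (hζ : ‖ζ‖ = 1) : kernel 0 ζ = 1 := by
  simp [kernel, hζ]

theorem continuous_restrict_sphere (hF : ContinuousOn F (sphere 0 1)) :
    Continuous fun ζ : sphere (0 : EuclideanSpace ℝ (Fin n)) 1 => F ζ :=
  continuousOn_iff_continuous_domRestrict.1 hF

theorem integrable_sphere {H : sphere (0 : EuclideanSpace ℝ (Fin n)) 1 → G} (hH : Continuous H) :
    Integrable H (sphereMeasure n) :=
  hH.integrable_of_hasCompactSupport (HasCompactSupport.of_compactSpace H)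

theorem exists_norm_le_on_sphere (hF : ContinuousOn F (sphere 0 1)) :
    ∃ C, ∀ ζ, ‖ζ‖ = 1 → ‖F ζ‖ ≤ C := by
  obtain ⟨C, hC⟩ :=
    (isCompact_sphere (0 : EuclideanSpace ℝ (Fin n)) 1).exists_bound_of_continuousOn hF
  exact ⟨C, fun ζ hζ => hC ζ (mem_sphere_zero_iff_norm.2 hζ)⟩

theorem kernel_le_of_le_norm_sub {ζ : EuclideanSpace ℝ (Fin n)} {δ : ℝ} (hx : ‖x‖ < 1)
    (hδ : 0 < δ) (h : δ ≤ ‖x - ζ‖) : kernel x ζ ≤ (1 - ‖x‖ ^ 2) / δ ^ n :=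
  div_le_div_of_nonneg_left (by nlinarith [norm_nonneg x]) (by positivity)
    (pow_le_pow_left₀ hδ.le h n)

variable [NormedSpace ℝ G]

/-- The Poisson integral of `F` with values in an arbitrary normed space. For a Euclidean target
this is `poissonIntegral`; real-valued `F` are the ones the maximum principle applies to. -/
noncomputable def poisson (F : EuclideanSpace ℝ (Fin n) → G) (x : EuclideanSpace ℝ (Fin n)) : G :=
  ∫ ζ : sphere (0 : EuclideanSpace ℝ (Fin n)) 1, kernel x ζ • F ζ ∂(sphereMeasure n)

theorem integrable_kernel_smul (hF : ContinuousOn F (sphere 0 1)) (hx : ‖x‖ < 1) :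
    Integrable (fun ζ : sphere (0 : EuclideanSpace ℝ (Fin n)) 1 => kernel x ζ • F ζ)
      (sphereMeasure n) :=
  integrable_sphere ((continuous_kernel_sphere hx).smul (continuous_restrict_sphere hF))

theorem integrable_kernel (hx : ‖x‖ < 1) :
    Integrable (fun ζ : sphere (0 : EuclideanSpace ℝ (Fin n)) 1 => kernel x ζ)
      (sphereMeasure n) :=
  integrable_sphere (continuous_kernel_sphere hx)

theorem continuousOn_poisson (hF : ContinuousOn F (sphere 0 1)) :
    ContinuousOn (poisson F) (ball 0 1) := by
  intro x hx
  rw [mem_ball_zero_iff] at hx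
  refine ContinuousAt.continuousWithinAt ?_
  obtain ⟨C, hC⟩ := exists_norm_le_on_sphere hF
  set δ := (1 - ‖x‖) / 2 with hδ
  have hδ0 : 0 < δ := by linarith
  have hnear : ∀ᶠ y in 𝓝 x, ‖y‖ < 1 - δ :=
    continuous_norm.continuousAt.eventually_lt continuousAt_const (by linarith)
  refine continuousAt_of_dominated (bound := fun _ => 1 / δ ^ n * C) ?_ ?_ (integrable_const _) ?_
  · filter_upwards [hnear] with y hy
    exact (integrable_kernel_smul hF (by linarith)).aestronglyMeasurable
  · filter_upwards [hnear] with y hy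
    refine Eventually.of_forall fun ζ => ?_
    have hζ := mem_sphere_zero_iff_norm.1 ζ.2
    have hy1 : ‖y‖ < 1 := by linarith
    have h1 : δ ≤ ‖y - ζ‖ := by
      have := norm_sub_norm_le (ζ : EuclideanSpace ℝ (Fin n)) y
      rw [norm_sub_rev] at this
      linarith
    rw [norm_smul, Real.norm_of_nonneg (kernel_nonneg hy1)]
    refine mul_le_mul ((kernel_le_of_le_norm_sub hy1 hδ0 h1).trans ?_) (hC ζ hζ)
      (norm_nonneg _) (by positivity)
    gcongr
    nlinarith [norm_nonneg y]
  · refine Eventually.of_forall fun ζ => ?_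
    have hne := sub_ne_zero_of_mem_ball hx (mem_sphere_zero_iff_norm.1 ζ.2)
    refine ContinuousAt.smul ?_ continuousAt_const
    unfold kernel
    exact ContinuousAt.div (by fun_prop) (by fun_prop) (by positivity)

/-- Differentiation under the integral sign: second differences of the kernel divided by `t²` are
bounded uniformly in `ζ` and tend to zero. -/
theorem hasSymmLaplacian_poisson {ι : Type*} [Fintype ι]
    (b : OrthonormalBasis ι ℝ (EuclideanSpace ℝ (Fin n)))
    {F : EuclideanSpace ℝ (Fin n) → ℝ} (hF : ContinuousOn F (sphere 0 1)) (hx : ‖x‖ < 1) :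
    HasSymmLaplacian b (poisson F) x 0 := by
  obtain ⟨B, hB⟩ := exists_norm_le_on_sphere hF
  obtain ⟨C, hC⟩ := exists_secondDiff_kernel_bound b hx
  have hline (c : EuclideanSpace ℝ (Fin n)) : ∀ᶠ t : ℝ in 𝓝[≠] 0, ‖x + t • c‖ < 1 := by
    refine nhdsWithin_le_nhds ?_
    have hc : Continuous fun t : ℝ => ‖x + t • c‖ := by fun_prop
    exact hc.continuousAt.eventually_lt continuousAt_const (by simpa using hx)
  have hin : ∀ᶠ t : ℝ in 𝓝[≠] 0, ∀ i, ‖x + t • b i‖ < 1 ∧ ‖x - t • b i‖ < 1 := by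
    filter_upwards [eventually_all.2 fun i => hline (b i), eventually_all.2 fun i => hline (-b i)]
      with t h1 h2 i
    have h3 := h2 i
    rw [smul_neg, ← sub_eq_add_neg] at h3
    exact ⟨h1 i, h3⟩
  have hint (t : ℝ) (ht : ∀ i, ‖x + t • b i‖ < 1 ∧ ‖x - t • b i‖ < 1) (i : ι) :
      Integrable (fun ζ : sphere (0 : EuclideanSpace ℝ (Fin n)) 1 =>
        kernel (x + t • b i) ζ • F ζ + kernel (x - t • b i) ζ • F ζ - 2 * (kernel x ζ • F ζ))
        (sphereMeasure n) :=
    ((integrable_kernel_smul hF (ht i).1).add (integrable_kernel_smul hF (ht i).2)).sub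
      ((integrable_kernel_smul hF hx).const_mul 2)
  have hfun (t : ℝ) (ζ : EuclideanSpace ℝ (Fin n)) :
      secondDiff b (fun y => kernel y ζ) x t / t ^ 2 * F ζ =
        (∑ i, (kernel (x + t • b i) ζ • F ζ + kernel (x - t • b i) ζ • F ζ -
          2 * (kernel x ζ • F ζ))) / t ^ 2 := by
    rw [secondDiff, div_mul_eq_mul_div, Finset.sum_mul]
    congr 1
    refine Finset.sum_congr rfl fun i _ => ?_
    simp only [smul_eq_mul]
    ring
  have hdiff : ∀ᶠ t : ℝ in 𝓝[≠] 0,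
      ∫ ζ : sphere (0 : EuclideanSpace ℝ (Fin n)) 1,
        secondDiff b (fun y => kernel y ζ) x t / t ^ 2 * F ζ ∂(sphereMeasure n) =
      secondDiff b (poisson F) x t / t ^ 2 := by
    filter_upwards [hin] with t ht
    simp only [hfun, integral_div]
    rw [integral_finsetSum _ fun i _ => hint t ht i, secondDiff]
    congr 1
    refine Finset.sum_congr rfl fun i _ => ?_
    have hadd : Integrable (fun ζ : sphere (0 : EuclideanSpace ℝ (Fin n)) 1 =>
        kernel (x + t • b i) ζ • F ζ + kernel (x - t • b i) ζ • F ζ) (sphereMeasure n) :=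
      (integrable_kernel_smul hF (ht i).1).add (integrable_kernel_smul hF (ht i).2)
    rw [integral_sub hadd ((integrable_kernel_smul hF hx).const_mul 2), integral_add (integrable_kernel_smul hF (ht i).1) (integrable_kernel_smul hF (ht i).2),
      integral_const_mul]
    rfl
  refine Tendsto.congr' hdiff ?_
  have hzero : ∫ ζ : sphere (0 : EuclideanSpace ℝ (Fin n)) 1, (0 : ℝ) * F ζ
      ∂(sphereMeasure n) = 0 := by simp
  suffices h : Tendsto (fun t : ℝ => ∫ ζ : sphere (0 : EuclideanSpace ℝ (Fin n)) 1,
      secondDiff b (fun y => kernel y ζ) x t / t ^ 2 * F ζ ∂(sphereMeasure n)) (𝓝[≠] 0)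
      (𝓝 (∫ ζ : sphere (0 : EuclideanSpace ℝ (Fin n)) 1, (0 : ℝ) * F ζ ∂(sphereMeasure n))) by
    rwa [hzero] at h
  refine tendsto_integral_filter_of_dominated_convergence (l := 𝓝[≠] (0 : ℝ))
    (f := fun ζ : sphere (0 : EuclideanSpace ℝ (Fin n)) 1 => (0 : ℝ) * F ζ)
    (fun _ => C * B) ?_ ?_ (integrable_const _) ?_
  · filter_upwards [hin] with t ht
    simp only [hfun]
    exact ((integrable_finsetSum _ fun i _ => hint t ht i).div_const _).aestronglyMeasurable
  · filter_upwards [hC] with t ht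
    refine Eventually.of_forall fun ζ => ?_
    have hζ := mem_sphere_zero_iff_norm.1 ζ.2
    rw [norm_mul]
    exact mul_le_mul (ht ζ hζ) (hB ζ hζ) (norm_nonneg _) ((abs_nonneg _).trans (ht ζ hζ))
  · refine Eventually.of_forall fun ζ => ?_
    exact Tendsto.mul_const (F ζ)
      (hasSymmLaplacian_kernel b (mem_sphere_zero_iff_norm.1 ζ.2) hx)

/-- The mass of the kernel is radial: the reflection exchanging `x` and `y` preserves the surface
measure. -/
theorem integral_kernel_eq_of_norm_eq {x y : EuclideanSpace ℝ (Fin n)} (h : ‖x‖ = ‖y‖) :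
    poisson (fun _ => (1 : ℝ)) x = poisson (fun _ => (1 : ℝ)) y := by
  set A := (ℝ ∙ (x - y))ᗮ.reflection
  have hA : A x = y := Submodule.reflection_sub h
  have hmp := measurePreserving_sphereMap A
  have hmeas : Measurable fun ζ : sphere (0 : EuclideanSpace ℝ (Fin n)) 1 =>
      kernel y (ζ : EuclideanSpace ℝ (Fin n)) • (1 : ℝ) := by
    unfold kernel
    fun_prop
  simp only [poisson]
  conv_rhs => rw [← hmp.map_eq]
  rw [integral_map hmp.measurable.aemeasurable hmeas.aestronglyMeasurable]
  refine integral_congr_ae (Eventually.of_forall fun ζ => ?_)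
  simp only [kernel, sphereMap, ← hA, ← map_sub, LinearIsometryEquiv.norm_map]

/-- The Poisson kernel has total mass one: its mass is a radial harmonic function of `x`, hence by
the maximum principle on the ball of radius `|x|` equal to its value at the centre. -/
theorem poisson_one (hn : n ≠ 0) (hx : ‖x‖ < 1) : poisson (fun _ => (1 : ℝ)) x = 1 := by
  have : Nonempty (Fin n) := Fin.pos_iff_nonempty.1 (Nat.pos_of_ne_zero hn)
  have := isProbabilityMeasure_sphereMeasure hn
  set h : EuclideanSpace ℝ (Fin n) → ℝ := poisson fun _ => (1 : ℝ)
  have h0 : h 0 = 1 := by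
    have (ζ : sphere (0 : EuclideanSpace ℝ (Fin n)) 1) :
        kernel 0 (ζ : EuclideanSpace ℝ (Fin n)) = 1 :=
      kernel_zero (mem_sphere_zero_iff_norm.1 ζ.2)
    simp [h, poisson, this]
  have hcont : ContinuousOn h (closedBall 0 ‖x‖) :=
    (continuousOn_poisson continuousOn_const).mono (closedBall_subset_ball hx)
  have hlap (y) (hy : y ∈ ball (0 : EuclideanSpace ℝ (Fin n)) ‖x‖) :
      HasSymmLaplacian (EuclideanSpace.basisFun (Fin n) ℝ) h y 0 :=
    hasSymmLaplacian_poisson _ continuousOn_const ((mem_ball_zero_iff.1 hy).trans hx)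
  have hconst (y : EuclideanSpace ℝ (Fin n)) :=
    hasSymmLaplacian_const (EuclideanSpace.basisFun (Fin n) ℝ) (h x) y
  have hrad (y) (hy : y ∈ sphere (0 : EuclideanSpace ℝ (Fin n)) ‖x‖) : h y = h x :=
    integral_kernel_eq_of_norm_eq (mem_sphere_zero_iff_norm.1 hy)
  have hmem : (0 : EuclideanSpace ℝ (Fin n)) ∈ closedBall 0 ‖x‖ :=
    mem_closedBall_self (norm_nonneg x)
  have h1 := nonpos_of_hasSymmLaplacian_nonneg (hcont.sub continuousOn_const)
    (fun y hy => ⟨0 - 0, by simp, (hlap y hy).sub (hconst y)⟩)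
    (fun y hy => by rw [Pi.sub_apply, hrad y hy, sub_self]) 0 hmem
  have h2 := nonpos_of_hasSymmLaplacian_nonneg (continuousOn_const.sub hcont)
    (fun y hy => ⟨0 - 0, by simp, (hconst y).sub (hlap y hy)⟩)
    (fun y hy => by rw [Pi.sub_apply, hrad y hy, sub_self]) 0 hmem
  simp only [Pi.sub_apply, h0] at h1 h2
  linarith

theorem integral_kernel (hn : n ≠ 0) (hx : ‖x‖ < 1) :
    ∫ ζ : sphere (0 : EuclideanSpace ℝ (Fin n)) 1, kernel x ζ ∂(sphereMeasure n) = 1 := by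
  simpa [poisson] using poisson_one hn hx

theorem norm_poisson_le (hn : n ≠ 0) {C : ℝ} (hC : ∀ ζ, ‖ζ‖ = 1 → ‖F ζ‖ ≤ C) (hx : ‖x‖ < 1) :
    ‖poisson F x‖ ≤ C := by
  have h := norm_integral_le_of_norm_le (μ := sphereMeasure n)
    (f := fun ζ : sphere (0 : EuclideanSpace ℝ (Fin n)) 1 => kernel x ζ • F ζ)
    ((integrable_kernel hx).mul_const C) (Eventually.of_forall fun ζ => by
      rw [norm_smul, Real.norm_of_nonneg (kernel_nonneg hx)]
      exact mul_le_mul_of_nonneg_left (hC ζ (mem_sphere_zero_iff_norm.1 ζ.2)) (kernel_nonneg hx))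
  rwa [integral_mul_const, integral_kernel hn hx, one_mul] at h

/-- The Poisson integral attains its boundary values. Near `ζ₀` the kernel is weighted by the
oscillation of `F`; away from `ζ₀` it is at most a constant times `1 - |x|²`. -/
theorem tendsto_poisson [CompleteSpace G] (hn : n ≠ 0) (hF : ContinuousOn F (sphere 0 1))
    {ζ₀ : EuclideanSpace ℝ (Fin n)} (hζ₀ : ‖ζ₀‖ = 1) :
    Tendsto (poisson F) (𝓝[ball 0 1] ζ₀) (𝓝 (F ζ₀)) := by
  have := isProbabilityMeasure_sphereMeasure hn
  obtain ⟨C, hC⟩ := exists_norm_le_on_sphere hF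
  have hC0 : 0 ≤ C := (norm_nonneg _).trans (hC ζ₀ hζ₀)
  rw [Metric.tendsto_nhds]
  intro ε hε
  obtain ⟨δ, hδ, hFδ⟩ := Metric.continuousWithinAt_iff.1
    (hF ζ₀ (mem_sphere_zero_iff_norm.2 hζ₀)) (ε / 2) (half_pos hε)
  have hlim : Tendsto (fun x : EuclideanSpace ℝ (Fin n) => (1 - ‖x‖ ^ 2) / (δ / 2) ^ n * (2 * C))
      (𝓝[ball 0 1] ζ₀) (𝓝 0) := by
    have hc : Continuous fun x : EuclideanSpace ℝ (Fin n) =>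
        (1 - ‖x‖ ^ 2) / (δ / 2) ^ n * (2 * C) := by fun_prop
    have h := hc.tendsto ζ₀
    rw [hζ₀] at h
    simpa using h.mono_left nhdsWithin_le_nhds
  filter_upwards [hlim.eventually_lt_const (half_pos hε), self_mem_nhdsWithin,
    nhdsWithin_le_nhds (ball_mem_nhds ζ₀ (half_pos hδ))] with x hxlim hx hxδ
  rw [mem_ball_zero_iff] at hx
  rw [mem_ball, dist_eq_norm] at hxδ
  have hsub : poisson F x - F ζ₀ = ∫ ζ : sphere (0 : EuclideanSpace ℝ (Fin n)) 1,
      kernel x ζ • (F ζ - F ζ₀) ∂(sphereMeasure n) := by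
    simp only [smul_sub]
    rw [integral_sub (integrable_kernel_smul hF hx) ((integrable_kernel hx).smul_const _),
      integral_smul_const, integral_kernel hn hx, one_smul]
    rfl
  rw [dist_eq_norm, hsub]
  have hint : Integrable (fun ζ : sphere (0 : EuclideanSpace ℝ (Fin n)) 1 =>
      kernel x ζ * (ε / 2) + (1 - ‖x‖ ^ 2) / (δ / 2) ^ n * (2 * C)) (sphereMeasure n) :=
    ((integrable_kernel hx).mul_const _).add (integrable_const _)
  have h := norm_integral_le_of_norm_le hint
    (f := fun ζ : sphere (0 : EuclideanSpace ℝ (Fin n)) 1 => kernel x ζ • (F ζ - F ζ₀))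
    (Eventually.of_forall fun ζ => by
      have hζ := mem_sphere_zero_iff_norm.1 ζ.2
      have hk := kernel_nonneg (ζ := (ζ : EuclideanSpace ℝ (Fin n))) hx
      have hx2 : 0 ≤ 1 - ‖x‖ ^ 2 := by nlinarith [norm_nonneg x]
      rw [norm_smul, Real.norm_of_nonneg hk]
      by_cases hd : dist (ζ : EuclideanSpace ℝ (Fin n)) ζ₀ < δ
      · have h1 := hFδ ζ.2 hd
        rw [dist_eq_norm] at h1
        have h2 := mul_le_mul_of_nonneg_left h1.le hk
        have h3 : 0 ≤ (1 - ‖x‖ ^ 2) / (δ / 2) ^ n * (2 * C) := by positivity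
        linarith
      · have h1 : δ / 2 ≤ ‖x - ζ‖ := by
          have h2 := norm_sub_le_norm_sub_add_norm_sub (ζ : EuclideanSpace ℝ (Fin n)) x ζ₀
          rw [dist_eq_norm, not_lt] at hd
          rw [norm_sub_rev x]
          linarith
        have h2 : ‖F ζ - F ζ₀‖ ≤ 2 * C := by
          have := norm_sub_le (F ζ) (F ζ₀)
          linarith [hC ζ hζ, hC ζ₀ hζ₀]
        have h3 := mul_le_mul (kernel_le_of_le_norm_sub hx (half_pos hδ) h1) h2 (norm_nonneg _)
          (by positivity)
        have h4 : 0 ≤ kernel x (ζ : EuclideanSpace ℝ (Fin n)) * (ε / 2) := by positivity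
        linarith)
  rw [integral_add ((integrable_kernel hx).mul_const _) (integrable_const _), integral_mul_const,
    integral_kernel hn hx, integral_const, probReal_univ, one_smul, one_mul] at h
  linarith

open Classical in
/-- One-sided comparison of a function with the Poisson integral of its boundary values: the
barrier `K (1 - |x|²) / (2n)` has Laplacian `-K` and vanishes on the sphere. -/
theorem sub_poisson_le (hn : n ≠ 0) {F : EuclideanSpace ℝ (Fin n) → ℝ}
    (hF : ContinuousOn F (closedBall 0 1)) (hF2 : ContDiffOn ℝ 2 F (ball 0 1)) {K : ℝ}
    (hK : ∀ y ∈ ball (0 : EuclideanSpace ℝ (Fin n)) 1, -K ≤ Laplacian.laplacian F y)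
    (hx : ‖x‖ < 1) : F x - poisson F x ≤ K / (2 * n) * (1 - ‖x‖ ^ 2) := by
  have : Nonempty (Fin n) := Fin.pos_iff_nonempty.1 (Nat.pos_of_ne_zero hn)
  have hn0 : (n : ℝ) ≠ 0 := Nat.cast_ne_zero.2 hn
  have hFS : ContinuousOn F (sphere 0 1) := hF.mono sphere_subset_closedBall
  -- The Poisson integral, extended to the sphere by its boundary values.
  set u : EuclideanSpace ℝ (Fin n) → ℝ := (ball 0 1).piecewise (poisson F) F with hu
  have hu_ball {y} (hy : y ∈ ball (0 : EuclideanSpace ℝ (Fin n)) 1) : u y = poisson F y :=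
    Set.piecewise_eq_of_mem _ _ _ hy
  have hu_sphere {y} (hy : y ∈ sphere (0 : EuclideanSpace ℝ (Fin n)) 1) : u y = F y :=
    Set.piecewise_eq_of_notMem _ _ _ fun h => (mem_ball.1 h).ne hy
  have hucont : ContinuousOn u (closedBall 0 1) := by
    intro y hy
    rcases (mem_closedBall.1 hy).lt_or_eq with h | h
    · have hnhds : ball (0 : EuclideanSpace ℝ (Fin n)) 1 ∈ 𝓝 y := isOpen_ball.mem_nhds h
      refine ((continuousOn_poisson hFS).continuousAt hnhds).continuousWithinAt
        |>.congr_of_eventuallyEq ?_ (hu_ball h)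
      filter_upwards [nhdsWithin_le_nhds hnhds] with z hz using hu_ball hz
    · have hS : y ∈ sphere (0 : EuclideanSpace ℝ (Fin n)) 1 := h
      rw [ContinuousWithinAt, hu_sphere hS, ← ball_union_sphere, nhdsWithin_union, tendsto_sup]
      constructor
      · refine (tendsto_poisson hn hFS (mem_sphere_zero_iff_norm.1 hS)).congr' ?_
        filter_upwards [self_mem_nhdsWithin] with z hz using (hu_ball hz).symm
      · refine (hFS y hS).tendsto.congr' ?_
        filter_upwards [self_mem_nhdsWithin] with z hz using (hu_sphere hz).symm
  have hmax := nonpos_of_hasSymmLaplacian_nonneg (b := EuclideanSpace.basisFun (Fin n) ℝ)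
    (u := fun y => F y - u y - K / (2 * n) * (1 - ‖y‖ ^ 2)) (r := 1)
    ((hF.sub hucont).sub (by fun_prop))
    (fun y hy => by
      have h1 := hasSymmLaplacian_laplacian (EuclideanSpace.basisFun (Fin n) ℝ)
        (hF2.contDiffAt (isOpen_ball.mem_nhds hy))
      have h2 : HasSymmLaplacian (EuclideanSpace.basisFun (Fin n) ℝ) u y 0 :=
        (hasSymmLaplacian_poisson _ hFS (mem_ball_zero_iff.1 hy)).congr_of_eventuallyEq
          (by filter_upwards [isOpen_ball.mem_nhds hy] with z hz using hu_ball hz)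
      have h3 := ((hasSymmLaplacian_const (EuclideanSpace.basisFun (Fin n) ℝ) 1 y).sub
        (hasSymmLaplacian_norm_sq _ y)).const_mul (K / (2 * n))
      refine ⟨_, ?_, (h1.sub h2).sub h3⟩
      have h4 : K / (2 * n) * (0 - 2 * (Fintype.card (Fin n) : ℝ)) = -K := by
        rw [Fintype.card_fin]
        field_simp
        ring
      rw [h4]
      linarith [hK y hy])
    (fun y hy => by
      rw [hu_sphere hy, mem_sphere_zero_iff_norm.1 hy]
      simp)
    x (mem_closedBall_zero_iff.2 hx.le)
  simp only [hu_ball (mem_ball_zero_iff.2 hx)] at hmax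
  linarith

theorem one_sub_sq_div_pow {r : ℝ} (hr : 0 ≤ r) (hn : n ≠ 0) :
    (1 - r ^ 2) / (1 + r) ^ n = (1 - r) / (1 + r) ^ (n - 1) := by
  have h : 1 + r ≠ 0 := by positivity
  obtain ⟨k, rfl⟩ := Nat.exists_eq_succ_of_ne_zero hn
  rw [Nat.succ_eq_add_one, Nat.add_sub_cancel, pow_succ]
  field_simp
  ring

/-- The minimum of the kernel over the sphere, from `|x - ζ| ≤ 1 + |x|`. -/
theorem le_kernel (hn : n ≠ 0) {ζ : EuclideanSpace ℝ (Fin n)} (hζ : ‖ζ‖ = 1) (hx : ‖x‖ < 1) :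
    (1 - ‖x‖) / (1 + ‖x‖) ^ (n - 1) ≤ kernel x ζ := by
  rw [← one_sub_sq_div_pow (norm_nonneg x) hn, kernel]
  have h0 := sub_ne_zero_of_mem_ball hx hζ
  refine div_le_div_of_nonneg_left (by nlinarith [norm_nonneg x]) (by positivity)
    (pow_le_pow_left₀ (norm_nonneg _) ?_ n)
  linarith [norm_sub_le x ζ]

/-- A Schwarz-type estimate: subtracting from the kernel its minimum over the sphere leaves a
nonnegative kernel of mass `1 - (1 - |x|) / (1 + |x|) ^ (n - 1)`. -/
theorem norm_poisson_sub_le (hn : n ≠ 0) (hF : ContinuousOn F (sphere 0 1)) {S : ℝ}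
    (hS : ∀ ζ, ‖ζ‖ = 1 → ‖F ζ‖ ≤ S) (hx : ‖x‖ < 1) :
    ‖poisson F x - ((1 - ‖x‖) / (1 + ‖x‖) ^ (n - 1)) • poisson F 0‖ ≤
      S * (1 - (1 - ‖x‖) / (1 + ‖x‖) ^ (n - 1)) := by
  have := isProbabilityMeasure_sphereMeasure hn
  set c := (1 - ‖x‖) / (1 + ‖x‖) ^ (n - 1)
  have hsub : poisson F x - c • poisson F 0 = ∫ ζ : sphere (0 : EuclideanSpace ℝ (Fin n)) 1,
      (kernel x ζ - c) • F ζ ∂(sphereMeasure n) := by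
    have h0 : Integrable (fun ζ : sphere (0 : EuclideanSpace ℝ (Fin n)) 1 =>
        c • kernel 0 (ζ : EuclideanSpace ℝ (Fin n)) • F ζ) (sphereMeasure n) :=
      (integrable_kernel_smul hF (by simp)).smul c
    rw [poisson, poisson, ← integral_smul, ← integral_sub (integrable_kernel_smul hF hx) h0]
    refine integral_congr_ae (Eventually.of_forall fun ζ => ?_)
    simp [kernel_zero (mem_sphere_zero_iff_norm.1 ζ.2), sub_smul]
  rw [hsub]
  have h := norm_integral_le_of_norm_le
    (f := fun ζ : sphere (0 : EuclideanSpace ℝ (Fin n)) 1 => (kernel x ζ - c) • F ζ)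
    (((integrable_kernel hx).sub (integrable_const c)).const_mul S)
    (Eventually.of_forall fun ζ => by
      have hζ := mem_sphere_zero_iff_norm.1 ζ.2
      have hk := sub_nonneg.2 (le_kernel hn hζ hx)
      rw [norm_smul, Real.norm_of_nonneg hk, mul_comm]
      exact mul_le_mul_of_nonneg_right (hS ζ hζ) hk)
  rwa [integral_const_mul, integral_sub' (integrable_kernel hx) (integrable_const c),
    integral_kernel hn hx, integral_const, probReal_univ, one_smul] at h

end Poisson

/-! ### The estimate for classical solutions and the extremal pair -/

section Estimate

variable {n m : ℕ} {f g : EuclideanSpace ℝ (Fin n) → EuclideanSpace ℝ (Fin m)}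
  {x : EuclideanSpace ℝ (Fin n)}

theorem norm_le_supNorm {u : EuclideanSpace ℝ (Fin n) → EuclideanSpace ℝ (Fin m)} {C : ℝ}
    (hC : ∀ y, ‖y‖ < 1 → ‖u y‖ ≤ C) (hx : ‖x‖ < 1) : ‖u x‖ ≤ supNorm u := by
  refine le_csSup ⟨C, ?_⟩ ⟨x, mem_ball_zero_iff.2 hx, rfl⟩
  rintro _ ⟨y, hy, rfl⟩
  exact hC y (mem_ball_zero_iff.1 hy)

theorem supNorm_eq_of_forall_norm_eq {u : EuclideanSpace ℝ (Fin n) → EuclideanSpace ℝ (Fin m)}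
    {C : ℝ} (hC : ∀ y, ‖y‖ < 1 → ‖u y‖ = C) : supNorm u = C := by
  rw [supNorm, Set.image_congr (g := fun _ => C) fun y hy => hC y (mem_ball_zero_iff.1 hy),
    (nonempty_ball.2 one_pos).image_const, csSup_singleton]

/-- The boundary values are limits of the Poisson integral, so they obey its bounds. -/
theorem norm_le_supNorm_poisson (hn : n ≠ 0) (hf : ContinuousOn f (sphere 0 1))
    {ζ : EuclideanSpace ℝ (Fin n)} (hζ : ‖ζ‖ = 1) : ‖f ζ‖ ≤ supNorm (poisson f) := by
  obtain ⟨C, hC⟩ := exists_norm_le_on_sphere hf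
  have hne : (𝓝[ball (0 : EuclideanSpace ℝ (Fin n)) 1] ζ).NeBot := by
    rw [← mem_closure_iff_nhdsWithin_neBot, closure_ball _ one_ne_zero]
    exact mem_closedBall_zero_iff.2 hζ.le
  refine le_of_tendsto (tendsto_poisson hn hf hζ).norm ?_
  filter_upwards [self_mem_nhdsWithin] with y hy
  exact norm_le_supNorm (fun z hz => norm_poisson_le hn hC hz) (mem_ball_zero_iff.1 hy)

theorem inner_poisson (hf : ContinuousOn f (sphere 0 1)) (e : EuclideanSpace ℝ (Fin m))
    (hx : ‖x‖ < 1) : poisson (fun y => inner ℝ e (f y)) x = inner ℝ e (poisson f x) := by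
  rw [poisson, poisson, ← integral_inner (integrable_kernel_smul hf hx)]
  simp only [inner_smul_right, smul_eq_mul]

/-- The part of a classical solution with zero boundary values is controlled by the right-hand
side, as the scalar comparison applies to its component in the direction of its value at `x`. -/
theorem IsClassicalSolution.norm_sub_poisson_le (h : IsClassicalSolution f g) (hn : n ≠ 0)
    (hx : ‖x‖ < 1) :
    ‖f x - poisson f x‖ ≤ supNorm g / (2 * n) * (1 - ‖x‖ ^ 2) := by
  have hfS : ContinuousOn f (sphere 0 1) := h.continuousOn.mono sphere_subset_closedBall
  obtain ⟨C, hC⟩ :=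
    (isCompact_closedBall (0 : EuclideanSpace ℝ (Fin n)) 1).exists_bound_of_continuousOn h.continuousOn_rhs
  have hg (y : EuclideanSpace ℝ (Fin n)) (hy : ‖y‖ < 1) : ‖g y‖ ≤ supNorm g :=
    norm_le_supNorm (fun z hz => hC z (mem_closedBall_zero_iff.2 hz.le)) hy
  set e := f x - poisson f x with he
  have hmain := sub_poisson_le hn (F := fun y => inner ℝ e (f y)) (K := ‖e‖ * supNorm g)
    (continuousOn_const.inner h.continuousOn) (contDiffOn_const.inner ℝ h.contDiffOn)
    (fun y hy => by
      have h1 := (h.contDiffOn.contDiffAt (isOpen_ball.mem_nhds hy)).laplacian_CLM_comp_left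
        (l := innerSL ℝ e)
      have h2 : Laplacian.laplacian (fun y => inner ℝ e (f y)) y = inner ℝ e (g y) := by
        rw [← h.laplacian_eq y hy]
        exact h1
      rw [h2]
      have h3 := (abs_le.1 (abs_real_inner_le_norm e (g y))).1
      have h4 := mul_le_mul_of_nonneg_left (hg y (mem_ball_zero_iff.1 hy)) (norm_nonneg e)
      linarith) hx
  rw [inner_poisson hfS e hx, ← inner_sub_right, ← he, real_inner_self_eq_norm_sq] at hmain
  rcases (norm_nonneg e).eq_or_lt with h0 | h0
  · rw [← h0]
    have hg0 := (norm_nonneg _).trans (hg x hx)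
    have hx2 : 0 ≤ 1 - ‖x‖ ^ 2 := by nlinarith [norm_nonneg x]
    positivity
  · refine le_of_mul_le_mul_left ?_ h0
    calc ‖e‖ * ‖e‖ = ‖e‖ ^ 2 := (sq _).symm
      _ ≤ _ := hmain
      _ = _ := by ring

/-- The estimate on the closed ball; on the sphere the coefficient of `poisson f 0` vanishes and
only the bound on the boundary values remains. -/
theorem IsClassicalSolution.norm_sub_smul_poisson_zero_le (h : IsClassicalSolution f g)
    (hn0 : n ≠ 0) (hx : ‖x‖ ≤ 1) :
    ‖f x - ((1 - ‖x‖) / (1 + ‖x‖) ^ (n - 1)) • poisson f 0‖ ≤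
      supNorm (poisson f) * (1 - (1 - ‖x‖) / (1 + ‖x‖) ^ (n - 1)) +
        supNorm g / (2 * (n : ℝ)) * (1 - ‖x‖ ^ 2) := by
  have hfS : ContinuousOn f (sphere 0 1) := h.continuousOn.mono sphere_subset_closedBall
  rcases hx.lt_or_eq with hx | hx
  · have h1 := norm_poisson_sub_le hn0 hfS (fun ζ hζ => norm_le_supNorm_poisson hn0 hfS hζ) hx
    have h2 := h.norm_sub_poisson_le hn0 hx
    have h3 := norm_sub_le_norm_sub_add_norm_sub (f x) (poisson f x)
      (((1 - ‖x‖) / (1 + ‖x‖) ^ (n - 1)) • poisson f 0)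
    linarith
  · simpa [hx] using norm_le_supNorm_poisson hn0 hfS hx

theorem laplacian_one_sub_norm_sq (M : ℝ) (x : EuclideanSpace ℝ (Fin n)) :
    Laplacian.laplacian (fun y => M * (1 - ‖y‖ ^ 2) : EuclideanSpace ℝ (Fin n) → ℝ) x =
      -(2 * n * M) := by
  have h1 := ((hasSymmLaplacian_const (EuclideanSpace.basisFun (Fin n) ℝ) 1 x).sub
    (hasSymmLaplacian_norm_sq _ x)).const_mul M
  have hsmooth : ContDiff ℝ 2 fun y : EuclideanSpace ℝ (Fin n) => M * (1 - ‖y‖ ^ 2) :=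
    contDiff_const.mul (contDiff_const.sub (contDiff_norm_sq ℝ))
  have h2 := hasSymmLaplacian_laplacian (EuclideanSpace.basisFun (Fin n) ℝ) hsmooth.contDiffAt
    (x := x)
  rw [tendsto_nhds_unique h2 h1, Fintype.card_fin]
  ring

theorem isClassicalSolution_single (i : Fin m) (M : ℝ)
    (hf : ∀ x ∈ closedBall (0 : EuclideanSpace ℝ (Fin n)) 1,
      f x = EuclideanSpace.single i (M * (1 - ‖x‖ ^ 2)))
    (hg : ∀ x ∈ closedBall (0 : EuclideanSpace ℝ (Fin n)) 1,
      g x = EuclideanSpace.single i (-(2 * (n : ℝ) * M))) :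
    IsClassicalSolution f g := by
  set L : ℝ →L[ℝ] EuclideanSpace ℝ (Fin m) :=
    ContinuousLinearMap.toSpanSingleton ℝ (EuclideanSpace.single i 1)
  have hL (a : ℝ) : EuclideanSpace.single i a = L a := by
    ext j
    simp [L, ContinuousLinearMap.toSpanSingleton_apply]
  have hsmooth : ContDiff ℝ 2 fun y : EuclideanSpace ℝ (Fin n) => M * (1 - ‖y‖ ^ 2) :=
    contDiff_const.mul (contDiff_const.sub (contDiff_norm_sq ℝ))
  have hfL : Set.EqOn f (L ∘ fun y => M * (1 - ‖y‖ ^ 2)) (closedBall 0 1) := fun y hy => by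
    rw [hf y hy, hL]; rfl
  refine ⟨continuousOn_const.congr hg, ?_, ?_, fun y hy => ?_⟩
  · exact (L.contDiff.comp hsmooth).contDiffOn.congr (hfL.mono ball_subset_closedBall)
  · exact (L.continuous.comp hsmooth.continuous).continuousOn.congr hfL
  · have hev : f =ᶠ[𝓝 y] L ∘ fun y => M * (1 - ‖y‖ ^ 2) := by
      filter_upwards [isOpen_ball.mem_nhds hy] with z hz using hfL (ball_subset_closedBall hz)
    rw [(InnerProductSpace.laplacian_congr_nhds hev).self_of_nhds,
      hsmooth.contDiffAt.laplacian_CLM_comp_left, Function.comp_apply,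
      laplacian_one_sub_norm_sq, hg y (ball_subset_closedBall hy), hL]

theorem poisson_eq_zero (hf : ∀ ζ, ‖ζ‖ = 1 → f ζ = 0) : poisson f = 0 := by
  ext1 x
  rw [poisson, Pi.zero_apply]
  refine integral_eq_zero_of_ae (Eventually.of_forall fun ζ => ?_)
  simp [hf ζ (mem_sphere_zero_iff_norm.1 ζ.2)]

end Estimate

end PoissonBall

theorem corollary1 (n m : ℕ) (hn : 3 ≤ n) (hm : 1 ≤ m) :
    (∀ f g : EuclideanSpace ℝ (Fin n) → EuclideanSpace ℝ (Fin m),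
      PoissonBall.IsClassicalSolution f g →
      ∀ x ∈ closedBall (0 : EuclideanSpace ℝ (Fin n)) 1,
        ‖f x - ((1 - ‖x‖) / (1 + ‖x‖) ^ (n - 1)) • PoissonBall.poissonIntegral f 0‖ ≤
          PoissonBall.supNorm (PoissonBall.poissonIntegral f) *
              (1 - (1 - ‖x‖) / (1 + ‖x‖) ^ (n - 1)) +
            PoissonBall.supNorm g / (2 * (n : ℝ)) * (1 - ‖x‖ ^ 2)) ∧
    (∀ M : ℝ, 0 < M →
      ∀ f g : EuclideanSpace ℝ (Fin n) → EuclideanSpace ℝ (Fin m),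
      (∀ x ∈ closedBall (0 : EuclideanSpace ℝ (Fin n)) 1,
        f x = EuclideanSpace.single (⟨0, hm⟩ : Fin m) (M * (1 - ‖x‖ ^ 2))) →
      (∀ x ∈ closedBall (0 : EuclideanSpace ℝ (Fin n)) 1,
        g x = EuclideanSpace.single (⟨0, hm⟩ : Fin m) (-(2 * (n : ℝ) * M))) →
      PoissonBall.IsClassicalSolution f g ∧
      ∀ x ∈ sphere (0 : EuclideanSpace ℝ (Fin n)) 1 ∪ {0},
        ‖f x - ((1 - ‖x‖) / (1 + ‖x‖) ^ (n - 1)) • PoissonBall.poissonIntegral f 0‖ =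
          PoissonBall.supNorm (PoissonBall.poissonIntegral f) *
              (1 - (1 - ‖x‖) / (1 + ‖x‖) ^ (n - 1)) +
            PoissonBall.supNorm g / (2 * (n : ℝ)) * (1 - ‖x‖ ^ 2)) := by
  have hn0 : n ≠ 0 := by omega
  refine ⟨fun f g h x hx => h.norm_sub_smul_poisson_zero_le hn0
    (mem_closedBall_zero_iff.1 hx), fun M hM f g hf hg => ?_⟩
  refine ⟨PoissonBall.isClassicalSolution_single _ M hf hg, fun x hx => ?_⟩
  have hP : PoissonBall.poissonIntegral f = 0 := PoissonBall.poisson_eq_zero fun ζ hζ => by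
    rw [hf ζ (mem_closedBall_zero_iff.2 hζ.le), hζ]
    simp
  have hP0 : PoissonBall.supNorm (PoissonBall.poissonIntegral f) = 0 :=
    PoissonBall.supNorm_eq_of_forall_norm_eq fun y _ => by simp [hP]
  have hG : PoissonBall.supNorm g = 2 * n * M :=
    PoissonBall.supNorm_eq_of_forall_norm_eq fun y hy => by
      rw [hg y (mem_closedBall_zero_iff.2 hy.le), PiLp.norm_single, norm_neg,
        Real.norm_of_nonneg (by positivity)]
  rw [hP0, hG, hP]
  rcases hx with hx | rfl
  · have hx1 := mem_sphere_zero_iff_norm.1 hx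
    rw [hf x (sphere_subset_closedBall hx), hx1]
    simp
  · rw [hf 0 (mem_closedBall_self zero_le_one)]
    have hn1 : (n : ℝ) ≠ 0 := Nat.cast_ne_zero.2 hn0
    simp only [Pi.zero_apply, smul_zero, sub_zero, norm_zero, PiLp.norm_single]
    rw [Real.norm_of_nonneg (by positivity)]
    field_simp
    ring
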